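/- Let $d$ be a natural number. A function $f\colon\mathbb{R}^d\to[0,\infty)$ is called *proper log-concave* if it is upper semi-continuous, has finite positive integral, and is log-concave, i.e. $f=e^{-\varphi}$ for a convex $\varphi\colon\mathbb{R}^d\to\mathbb{R}\cup\{+\infty\}$. For $s\in[0,\infty)$ and $t\ge 0$ put $\psi_0(t)=t$ and, for $s>0$, $$\psi_s(t)=\frac{s}{2}\left[\sqrt{1+4\left(\tfrac{t}{s}\right)^2}-\ln\left(\frac{1+\sqrt{1+4(t/s)^2}}{2}\right)-1\right],$$ and let $$\mathcal{F}_s=\left\{x\mapsto\alpha e^{-\psi_s(|A(x-a)|)}\;:\;A\in\mathrm{GL}(d),\ \alpha>0,\ a\in\mathbb{R}^d\right\}.$$ A *Löwner $s$-function* of $f$ is a function $L\in\mathcal{F}_s$ with $f\le L$ pointwise whose integral over $\mathbb{R}^d$ is minimal among all $\ell\in\mathcal{F}_s$ with $f\le\ell$ pointwise. A *Löwner function of $f$ in the sense of Li–Schütt–Werner* is defined in the same way with $\mathcal{F}_s$ replaced by the class of all functions $x\mapsto\alpha e^{-|Tx|}$, where $\alpha>0$ and $T$ is a nonsingular affine transformation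 of $\mathbb{R}^d$. **Theorem 1.3.** Let $f\colon\mathbb{R}^d\to[0,\infty)$ be a proper log-concave function. Then for every $s\in[0,\infty)$ there is exactly one Löwner $s$-function $L_s$ of $f$, there is exactly one Löwner function of $f$ in the sense of Li–Schütt–Werner, the latter is equal to $L_0$, and $L_s\to L_0$ uniformly on $\mathbb{R}^d$ as $s\to 0^+$. -/

import Mathlib

open MeasureTheory Filter Topology

namespace Lowner

/-- A function with values in `[0, ∞)` is log-concave, i.e. of the form `exp (-φ)` with `φ` convex
and values in `ℝ ∪ {+∞}`. (The exponents are positive, so `0 ^ a = 0` here.) -/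
def LogConcave {d : ℕ} (f : EuclideanSpace ℝ (Fin d) → ℝ) : Prop :=
  (∀ x, 0 ≤ f x) ∧
    ∀ x y : EuclideanSpace ℝ (Fin d), ∀ a b : ℝ, 0 < a → 0 < b → a + b = 1 →
      f x ^ a * f y ^ b ≤ f (a • x + b • y)

/-- Proper log-concave: log-concave, upper semi-continuous, of finite positive integral. -/
structure IsProperLogConcave {d : ℕ} (f : EuclideanSpace ℝ (Fin d) → ℝ) : Prop where
  logConcave : LogConcave f
  upperSemicontinuous : UpperSemicontinuous f
  integrable : Integrable f
  integral_pos : 0 < ∫ x, f x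

/-- The profile `ψ_s`, used for `0 ≤ s` and `0 ≤ t`. -/
noncomputable def psi (s t : ℝ) : ℝ :=
  if s = 0 then t
  else s / 2 * (√(1 + 4 * (t / s) ^ 2) - Real.log ((1 + √(1 + 4 * (t / s) ^ 2)) / 2) - 1)

/-- The class of `ψ`-ellipsoidal functions `x ↦ α exp (-ψ(|A (x - a)|))` with `α > 0`, `A`
invertible linear and `a ∈ ℝ^d`. -/
def ellipsoidalClass (d : ℕ) (ψ : ℝ → ℝ) : Set (EuclideanSpace ℝ (Fin d) → ℝ) :=
  {ℓ | ∃ (A : EuclideanSpace ℝ (Fin d) ≃L[ℝ] EuclideanSpace ℝ (Fin d)) (α : ℝ)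
      (a : EuclideanSpace ℝ (Fin d)),
      0 < α ∧ ∀ x, ℓ x = α * Real.exp (-ψ ‖A (x - a)‖)}

/-- The class of functions `x ↦ α exp (-|T x|)` with `α > 0` and `T` an invertible affine map. -/
def affineExpClass (d : ℕ) : Set (EuclideanSpace ℝ (Fin d) → ℝ) :=
  {ℓ | ∃ (T : EuclideanSpace ℝ (Fin d) ≃ᵃ[ℝ] EuclideanSpace ℝ (Fin d)) (α : ℝ),
      0 < α ∧ ∀ x, ℓ x = α * Real.exp (-‖T x‖)}

/-- `L` has the smallest integral among the members of the class `C` that are pointwise at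
least `f`. -/
def IsMinimalMajorant {d : ℕ} (C : Set (EuclideanSpace ℝ (Fin d) → ℝ))
    (f L : EuclideanSpace ℝ (Fin d) → ℝ) : Prop :=
  L ∈ C ∧ (∀ x, f x ≤ L x) ∧ ∀ ℓ ∈ C, (∀ x, f x ≤ ℓ x) → ∫ x, L x ≤ ∫ x, ℓ x

/-- `L` is a Löwner `s`-function of `f`. -/
def IsLownerFunction {d : ℕ} (s : ℝ) (f L : EuclideanSpace ℝ (Fin d) → ℝ) : Prop :=
  IsMinimalMajorant (ellipsoidalClass d (psi s)) f L

/-- `L` is a Löwner function of `f` in the sense of Li, Schütt and Werner. -/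
def IsLownerFunctionLSW {d : ℕ} (f L : EuclideanSpace ℝ (Fin d) → ℝ) : Prop :=
  IsMinimalMajorant (affineExpClass d) f L

end Lowner

open MeasureTheory Filter Topology

namespace Lowner

/-! The integral of `x ↦ α exp (-ψ ‖A x - b‖)` is `α / |det A|` times a constant depending only on
`ψ`, so the problem is to minimize `α / |det A|` over triples `(A, b, α)`. The Li–Schütt–Werner
class is the case `s = 0`, since an invertible affine map has the form `x ↦ A (x - a)`.

Existence is compactness. Exponential decay of `f` provides one majorant. Conversely `f` is bounded
below on some ball, which forces `‖A x - b‖ = O(log α)` there and hence `|det A| = O((log α) ^ d)`;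
together with `α ≤ J |det A|` this bounds `α`, then `A` and `b` (`isCompact_relaxedParams`).

Uniqueness compares two minimizers. After simultaneous diagonalization, averaging the linear parts
and taking the geometric mean of the factors gives another majorant, and the equality case of AM-GM
forces the linear parts to agree up to an isometry (`IsMinimalParam.norm_apply_eq`). If the centers
differed, the minimum of the two translates would fit under a majorant of smaller integral
(`IsMinimalParam.center_eq`, through `exists_dilation`).

For the limit, `t / 2 - 1 ≤ ψ_s t ≤ t` for `s ≤ 1` puts all minimizers in one compact set. Their
limits minimize for `s = 0`, so uniqueness identifies the limit function. Uniformity follows by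
tracking bad points, which either converge or escape to infinity, where both functions vanish. -/

/-- The properties of the profiles `ψ_s` on which existence and uniqueness of minimal majorants
rest. -/
structure IsProfile (ψ : ℝ → ℝ) : Prop where
  continuous : Continuous ψ
  map_zero : ψ 0 = 0
  convexOn : ConvexOn ℝ (Set.Ici 0) ψ
  pos : ∀ t, 0 < t → 0 < ψ t
  le_self : ∀ t, 0 ≤ t → ψ t ≤ t

/-! ### Convex profiles -/

namespace IsProfile

variable {ψ : ℝ → ℝ} (hψ : IsProfile ψ)
include hψ

theorem nonneg {t : ℝ} (ht : 0 ≤ t) : 0 ≤ ψ t := by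
  rcases ht.eq_or_lt with rfl | h
  · exact hψ.map_zero.ge
  · exact (hψ.pos t h).le

/-- The slopes of chords from the origin increase. -/
theorem mul_le_mul {a b : ℝ} (ha : 0 ≤ a) (hab : a ≤ b) : b * ψ a ≤ a * ψ b := by
  rcases (ha.trans hab).eq_or_lt with rfl | hb
  · obtain rfl : a = 0 := le_antisymm hab ha
    simp
  have h := hψ.convexOn.2 (Set.mem_Ici.2 hb.le) (Set.mem_Ici.2 le_rfl)
    (show 0 ≤ a / b by positivity) (show 0 ≤ 1 - a / b by rwa [sub_nonneg, div_le_one hb])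
    (by ring)
  simp only [smul_eq_mul, mul_zero, add_zero, hψ.map_zero, div_mul_cancel₀ _ hb.ne'] at h
  calc b * ψ a ≤ b * (a / b * ψ b) := by gcongr
    _ = a * ψ b := by field_simp

theorem mono {a b : ℝ} (ha : 0 ≤ a) (hab : a ≤ b) : ψ a ≤ ψ b := by
  rcases (ha.trans hab).eq_or_lt with rfl | hb
  · obtain rfl : a = 0 := le_antisymm hab ha
    exact le_rfl
  have h := hψ.mul_le_mul ha hab
  have h2 : a * ψ b ≤ b * ψ b := mul_le_mul_of_nonneg_right hab (hψ.nonneg hb.le)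
  exact le_of_mul_le_mul_left (h.trans h2) hb

theorem linear_lower_bound {t : ℝ} (ht : 0 ≤ t) : ψ 1 * t - ψ 1 ≤ ψ t := by
  have h1 := hψ.pos 1 one_pos
  rcases le_total 1 t with h | h
  · have := hψ.mul_le_mul zero_le_one h
    nlinarith
  · have := hψ.nonneg ht
    nlinarith

theorem midpoint_le {u v w : ℝ} (hu : 0 ≤ u) (hv : 0 ≤ v) (hw : 0 ≤ w) (h : w ≤ (u + v) / 2) :
    ψ w ≤ (ψ u + ψ v) / 2 := by
  have h2 := hψ.convexOn.2 (Set.mem_Ici.2 hu) (Set.mem_Ici.2 hv)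
    (show (0 : ℝ) ≤ 1 / 2 by norm_num) (show (0 : ℝ) ≤ 1 / 2 by norm_num) (by norm_num)
  simp only [smul_eq_mul] at h2
  have h3 := hψ.mono hw h
  rw [show 1 / 2 * u + 1 / 2 * v = (u + v) / 2 by ring] at h2
  linarith

/-- Replacing `r` by `√(r² + v²)` raises the profile enough to pay for a small dilation. -/
theorem exists_dilation {v : ℝ} (hv : 0 < v) (d : ℕ) :
    ∃ ε δ : ℝ, 0 < ε ∧ ε < 1 ∧ Real.exp (-δ) < (1 - ε) ^ d ∧
      ∀ r, 0 ≤ r → δ + ψ ((1 - ε) * r) ≤ ψ (√(r ^ 2 + v ^ 2)) := by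
  -- `k / v` is the slope of the chord of `ψ` over `[0, v / 4]`. With `ε = η ^ 2` and `δ = k * η`,
  -- the gain is of first order in `η` and the cost `(1 - η ^ 2) ^ d` of second order, so a small
  -- `η` works.
  set k := 4 * ψ (v / 4) with hk
  have hkpos : 0 < k := by have := hψ.pos (v / 4) (by positivity); positivity
  have hd : (0 : ℝ) ≤ d := Nat.cast_nonneg d
  obtain ⟨η, hη0, hη1, hη2, hη3⟩ : ∃ η : ℝ, 0 < η ∧ η ≤ 1 / 2 ∧ 2 * d * η < k ∧ 2 * d * η < 1 := by
    refine ⟨min (1 / 2) (min (k / (2 * d + 1)) (1 / (2 * d + 1)) / 2), by positivity,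
      min_le_left _ _, ?_, ?_⟩
    · have h1 : min (1 / 2) (min (k / (2 * d + 1)) (1 / (2 * d + 1)) / 2) ≤ k / (2 * d + 1) / 2 :=
        (min_le_right _ _).trans (by gcongr; exact min_le_left _ _)
      calc 2 * (d : ℝ) * _ ≤ 2 * d * (k / (2 * d + 1) / 2) := by gcongr
        _ < k := by
          rw [div_div, mul_div_assoc', div_lt_iff₀ (by positivity)]
          nlinarith
    · have h1 : min (1 / 2) (min (k / (2 * d + 1)) (1 / (2 * d + 1)) / 2) ≤ 1 / (2 * d + 1) / 2 :=
        (min_le_right _ _).trans (by gcongr; exact min_le_right _ _)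
      calc 2 * (d : ℝ) * _ ≤ 2 * d * (1 / (2 * d + 1) / 2) := by gcongr
        _ < 1 := by
          rw [div_div, mul_div_assoc', div_lt_iff₀ (by positivity)]
          nlinarith
  have hη4 : η ^ 2 < 1 := by nlinarith
  refine ⟨η ^ 2, k * η, by positivity, hη4, ?_, ?_⟩
  · have h1 : 1 + (d : ℝ) * (-η ^ 2) ≤ (1 + -η ^ 2) ^ d := one_add_mul_le_pow (by nlinarith) d
    have h2 : k * η + 1 ≤ Real.exp (k * η) := Real.add_one_le_exp _
    rw [← sub_eq_add_neg] at h1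
    refine lt_of_lt_of_le ?_ h1
    rw [Real.exp_neg, inv_lt_iff_one_lt_mul₀ (Real.exp_pos _)]
    have h3 : 0 < 1 + (d : ℝ) * -η ^ 2 := by nlinarith
    calc 1 < (k * η + 1) * (1 + (d : ℝ) * -η ^ 2) := by
          have e1 : 2 * d * η * η < k * η := by gcongr
          have e2 : 0 ≤ k * η * (1 - 2 * d * η * η) := by
            apply mul_nonneg (by positivity); nlinarith
          nlinarith
      _ ≤ _ := by rw [mul_comm]; gcongr
  · intro r hr
    have hb : (1 - η ^ 2) * r + v * η ≤ √(r ^ 2 + v ^ 2) := by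
      apply Real.le_sqrt_of_sq_le
      have h1 : 0 ≤ η ^ 2 * (1 - η ^ 2) * (r ^ 2 + v ^ 2) := by
        have : 0 ≤ 1 - η ^ 2 := by linarith
        positivity
      nlinarith [sq_nonneg ((1 - η ^ 2) * v - r * η)]
    have ha : 0 ≤ (1 - η ^ 2) * r := mul_nonneg (by linarith) hr
    set a := (1 - η ^ 2) * r
    set b := √(r ^ 2 + v ^ 2)
    -- Beyond `v / 4` chord slopes are at least `k / v`, so the extra length `v * η` yields `k * η`.
    -- Below it, `ψ a ≤ k / 4` while `ψ b ≥ ψ v ≥ k`, and `η ≤ 1 / 2`.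
    rcases le_total (v / 4) a with h | h
    · have e1 := hψ.mul_le_mul (by positivity) h
      have e2 := hψ.mul_le_mul ha (by nlinarith [mul_pos hv hη0] : a ≤ b)
      have e3 : 0 < a := lt_of_lt_of_le (by positivity) h
      have e4 : k * η + ψ a ≤ b * ψ a / a := by
        have e8 : 0 ≤ ψ a / a := div_nonneg (hψ.nonneg ha) ha
        have e9 : (a + v * η) * (ψ a / a) ≤ b * (ψ a / a) := by gcongr
        have e10 : a * (ψ a / a) = ψ a := by field_simp
        have e11 : v / 4 * ψ a / a ≥ ψ (v / 4) := by
          rw [ge_iff_le, le_div_iff₀ e3]; linarith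
        have e12 : k * η ≤ v * (ψ a / a) * η := by
          gcongr
          have : v / 4 * ψ a / a = v * (ψ a / a) / 4 := by ring
          linarith
        rw [mul_div_assoc]
        nlinarith
      refine e4.trans ?_
      rw [div_le_iff₀ e3]; linarith
    · have hvb : v ≤ b := Real.le_sqrt_of_sq_le (by nlinarith)
      have e1 := hψ.mul_le_mul (by positivity : 0 ≤ v / 4) (by linarith : v / 4 ≤ v)
      have e2 := hψ.mono hv.le hvb
      have e3 := hψ.mono ha h
      have e4 : 4 * ψ (v / 4) ≤ ψ v := by
        by_contra! hh
        nlinarith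
      nlinarith

end IsProfile

/-! ### The profiles `ψ_s` -/

theorem psi_zero_left (t : ℝ) : psi 0 t = t := by simp [psi]

theorem isProfile_psi_zero : IsProfile (psi 0) := by
  have : psi 0 = id := funext psi_zero_left
  rw [this]
  exact ⟨continuous_id, rfl, convexOn_id (convex_Ici 0), fun t h => h, fun t _ => le_rfl⟩

theorem hasDerivAt_psi {s : ℝ} (hs : 0 < s) (t : ℝ) :
    HasDerivAt (psi s) (2 * (t / s) / (1 + √(1 + 4 * (t / s) ^ 2))) t := by
  have hpos : 0 < 1 + 4 * (t / s) ^ 2 := by positivity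
  have h1 : HasDerivAt (fun t : ℝ => 1 + 4 * (t / s) ^ 2) (8 * (t / s) / s) t := by
    have := (((hasDerivAt_id t).div_const s).pow 2).const_mul 4 |>.const_add 1
    exact this.congr_deriv (by simp only [id]; ring)
  have h2 := h1.sqrt hpos.ne'
  have h3 := ((h2.const_add 1).div_const 2).log (by positivity)
  have h4 := ((h2.sub h3).sub_const 1).const_mul (s / 2)
  have e : psi s = fun t => s / 2 * (√(1 + 4 * (t / s) ^ 2) -
      Real.log ((1 + √(1 + 4 * (t / s) ^ 2)) / 2) - 1) := by
    funext t; simp [psi, hs.ne']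
  rw [e]
  refine h4.congr_deriv ?_
  have hq : 0 < √(1 + 4 * (t / s) ^ 2) := by positivity
  set q := √(1 + 4 * (t / s) ^ 2)
  field_simp
  ring

theorem psi_zero_right (s : ℝ) : psi s 0 = 0 := by
  by_cases h : s = 0 <;> simp [psi, h]

theorem psi_le_self {s t : ℝ} (hs : 0 ≤ s) (ht : 0 ≤ t) : psi s t ≤ t := by
  rcases hs.eq_or_lt with rfl | hs
  · exact (psi_zero_left t).le
  rw [psi, if_neg hs.ne']
  have hu : 0 ≤ t / s := by positivity
  have e : t = s * (t / s) := by field_simp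
  set u := t / s
  have h1 : √(1 + 4 * u ^ 2) ≤ 1 + 2 * u := Real.sqrt_le_iff.2 ⟨by positivity, by nlinarith⟩
  have h2 : 1 ≤ √(1 + 4 * u ^ 2) := Real.one_le_sqrt.2 (by nlinarith)
  have h3 : 0 ≤ Real.log ((1 + √(1 + 4 * u ^ 2)) / 2) := Real.log_nonneg (by linarith)
  rw [e]
  calc _ ≤ s / 2 * (2 * u) := by gcongr; linarith
    _ = s * u := by ring

/-- With `u = t / s`, the square root is at least `2u` and the logarithm at most `log (1 + u) ≤
2√u`. Paired with `psi_le_self`, this squeezes `ψ_s` to the identity as `s → 0`. -/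
theorem le_psi {s t : ℝ} (hs : 0 ≤ s) (ht : 0 ≤ t) : t - √(s * t) - s / 2 ≤ psi s t := by
  rcases hs.eq_or_lt with rfl | hs
  · simp [psi_zero_left]
  rw [psi, if_neg hs.ne']
  have hu : 0 ≤ t / s := by positivity
  have e : t = s * (t / s) := by field_simp
  have e2 : √(s * t) = s * √(t / s) := by
    rw [show s * t = s ^ 2 * (t / s) by field_simp, Real.sqrt_mul (by positivity),
      Real.sqrt_sq hs.le]
  rw [e2]
  set u := t / s
  have h1 : √(1 + 4 * u ^ 2) ≤ 1 + 2 * u := Real.sqrt_le_iff.2 ⟨by positivity, by nlinarith⟩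
  have h2 : 2 * u ≤ √(1 + 4 * u ^ 2) := Real.le_sqrt_of_sq_le (by nlinarith)
  have h3 : Real.log ((1 + √(1 + 4 * u ^ 2)) / 2) ≤ 2 * √u := by
    calc _ ≤ Real.log (1 + u) := by
          apply Real.log_le_log (by positivity); linarith
      _ ≤ Real.log ((1 + √u) ^ 2) := by
          apply Real.log_le_log (by positivity)
          nlinarith [Real.sq_sqrt hu, Real.sqrt_nonneg u]
      _ = 2 * Real.log (1 + √u) := by rw [Real.log_pow]; norm_num
      _ ≤ 2 * √u := by
          have := Real.log_le_sub_one_of_pos (x := 1 + √u) (by positivity)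
          linarith
  rw [e]
  calc s * u - s * √u - s / 2 = s / 2 * (2 * u - 2 * √u - 1) := by ring
    _ ≤ _ := by gcongr

theorem isProfile_psi {s : ℝ} (hs : 0 ≤ s) : IsProfile (psi s) := by
  rcases hs.eq_or_lt with rfl | hs
  · exact isProfile_psi_zero
  have hc : Continuous (psi s) :=
    continuous_iff_continuousAt.2 fun t => (hasDerivAt_psi hs t).continuousAt
  have hd : deriv (psi s) = fun t => 2 * (t / s) / (1 + √(1 + 4 * (t / s) ^ 2)) :=
    funext fun t => (hasDerivAt_psi hs t).deriv
  refine ⟨hc, psi_zero_right s, ?_, ?_, fun t ht => psi_le_self hs.le ht⟩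
  · apply MonotoneOn.convexOn_of_deriv (convex_Ici 0) hc.continuousOn
    · exact fun t _ => (hasDerivAt_psi hs t).differentiableAt.differentiableWithinAt
    · rw [hd]
      intro a ha b hb hab
      rw [interior_Ici] at ha hb
      have hu : 0 < a / s := div_pos ha hs
      have huv : a / s ≤ b / s := by gcongr
      show 2 * (a / s) / (1 + √(1 + 4 * (a / s) ^ 2)) ≤ 2 * (b / s) / (1 + √(1 + 4 * (b / s) ^ 2))
      generalize a / s = u at *
      generalize b / s = v at *
      rw [div_le_div_iff₀ (by positivity) (by positivity)]
      have : u * √(1 + 4 * v ^ 2) ≤ v * √(1 + 4 * u ^ 2) := by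
        refine (pow_le_pow_iff_left₀ (by positivity)
          (by have := hu.trans_le huv; positivity) two_ne_zero).1 ?_
        rw [mul_pow, mul_pow, Real.sq_sqrt (by positivity), Real.sq_sqrt (by positivity)]
        nlinarith
      linarith
  · have hm : StrictMonoOn (psi s) (Set.Ici 0) := by
      apply strictMonoOn_of_deriv_pos (convex_Ici 0) hc.continuousOn
      rw [hd, interior_Ici]
      intro t ht
      have : 0 < t / s := div_pos ht hs
      positivity
    intro t ht
    have := hm (Set.mem_Ici.2 le_rfl) (Set.mem_Ici.2 ht.le) ht
    rwa [psi_zero_right] at this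

theorem half_sub_one_le_psi {s t : ℝ} (hs : 0 ≤ s) (hs1 : s ≤ 1) (ht : 0 ≤ t) :
    1 / 2 * t - 1 ≤ psi s t := by
  have h := le_psi hs ht
  have h2 : √(s * t) ≤ √t := Real.sqrt_le_sqrt (by nlinarith)
  nlinarith [Real.sq_sqrt ht, sq_nonneg (√t - 1)]

theorem tendsto_psi {ι : Type*} {l : Filter ι} {s t : ι → ℝ} {t₀ : ℝ}
    (hs : Tendsto s l (𝓝 0)) (hs0 : ∀ᶠ i in l, 0 ≤ s i) (ht0 : ∀ i, 0 ≤ t i)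
    (ht : Tendsto t l (𝓝 t₀)) : Tendsto (fun i => psi (s i) (t i)) l (𝓝 t₀) := by
  have h : Tendsto (fun i => t i - √(s i * t i) - s i / 2) l (𝓝 (t₀ - √(0 * t₀) - 0 / 2)) :=
    (ht.sub (hs.mul ht).sqrt).sub (hs.div_const 2)
  simp only [zero_mul, Real.sqrt_zero, sub_zero, zero_div] at h
  refine tendsto_of_tendsto_of_tendsto_of_le_of_le' h ht ?_ ?_
  · filter_upwards [hs0] with i hi using le_psi hi (ht0 i)
  · filter_upwards [hs0] with i hi using psi_le_self hi (ht0 i)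

/-! ### Exponential decay of proper log-concave functions -/

abbrev Euc (d : ℕ) : Type := EuclideanSpace ℝ (Fin d)

variable {d : ℕ} {f : Euc d → ℝ}

theorem LogConcave.convex_superlevel (hf : LogConcave f) {c : ℝ} (hc : 0 < c) :
    Convex ℝ {x | c ≤ f x} := by
  rw [convex_iff_forall_pos]
  intro x hx y hy a b ha hb hab
  calc c = c ^ a * c ^ b := by rw [← Real.rpow_add hc, hab, Real.rpow_one]
    _ ≤ f x ^ a * f y ^ b := by
      have := hf.1 x
      gcongr <;> assumption
    _ ≤ _ := hf.2 x y a b ha hb hab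

/-- Some superlevel set has positive measure. It is convex, so its frontier is null and its interior
cannot be empty. -/
theorem IsProperLogConcave.exists_ball (hf : IsProperLogConcave f) :
    ∃ (x₀ : Euc d) (ρ m : ℝ), 0 < ρ ∧ 0 < m ∧ ∀ x ∈ Metric.ball x₀ ρ, m ≤ f x := by
  have hsupp : 0 < volume (Function.support f) :=
    (integral_pos_iff_support_of_nonneg hf.logConcave.1 hf.integrable).1 hf.integral_pos
  have hU : Function.support f ⊆ ⋃ n : ℕ, {x | 1 / ((n : ℝ) + 1) ≤ f x} := by
    intro x hx
    have hx : 0 < f x := lt_of_le_of_ne (hf.logConcave.1 x) (Ne.symm hx)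
    obtain ⟨n, hn⟩ := exists_nat_one_div_lt hx
    exact Set.mem_iUnion.2 ⟨n, hn.le⟩
  obtain ⟨n, hn⟩ : ∃ n : ℕ, volume {x | 1 / ((n : ℝ) + 1) ≤ f x} ≠ 0 := by
    by_contra! h
    exact (hsupp.trans_le (measure_mono hU)).ne' (measure_iUnion_null h)
  have hc : (0 : ℝ) < 1 / ((n : ℝ) + 1) := by positivity
  have hconv := hf.logConcave.convex_superlevel hc
  have hint : (interior {x | 1 / ((n : ℝ) + 1) ≤ f x}).Nonempty := by
    by_contra! h
    refine hn (measure_mono_null ?_ (hconv.addHaar_frontier volume))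
    rw [frontier, h, Set.sdiff_empty]
    exact subset_closure
  obtain ⟨x₀, hx₀⟩ := hint
  obtain ⟨ρ, hρ, hb⟩ := Metric.isOpen_iff.1 isOpen_interior x₀ hx₀
  exact ⟨x₀, ρ, _, hρ, hc, fun x hx => (interior_subset (hb hx) : x ∈ {x | _ ≤ f x})⟩

/-- A far point `x` of `S` and the ball span a cone in `S`. Its first half contains `N` disjoint
balls of radius `ρ / 2`, of total volume above that of `S`. -/
theorem exists_bound_of_convex_of_measure_ne_top {S : Set (Euc d)} (hS : Convex ℝ S) {x₀ : Euc d}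
    {ρ : ℝ} (hρ : 0 < ρ) (hball : Metric.ball x₀ ρ ⊆ S) (hvol : volume S ≠ ⊤) :
    ∃ R : ℝ, 0 < R ∧ ∀ x ∈ S, ‖x - x₀‖ < R := by
  have hv0 : volume (Metric.ball (0 : Euc d) (ρ / 2)) ≠ 0 :=
    (Metric.measure_ball_pos volume _ (by positivity)).ne'
  obtain ⟨N, hN⟩ := ENNReal.exists_nat_mul_gt hv0 hvol
  have hN0 : 0 < N := by
    rcases Nat.eq_zero_or_pos N with rfl | h
    · simp at hN
    · exact h
  have hN0' : (0 : ℝ) < N := Nat.cast_pos.2 hN0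
  refine ⟨2 * N * ρ, by positivity, fun x hx => ?_⟩
  by_contra! hR
  let B : ℕ → Set (Euc d) := fun k => Metric.ball (x₀ + ((k : ℝ) / (2 * N)) • (x - x₀)) (ρ / 2)
  have hsub : (⋃ k ∈ Finset.range N, B k) ⊆ S := by
    refine Set.iUnion₂_subset fun k hk y hy => ?_
    have hkN : (k : ℝ) < N := Nat.cast_lt.2 (Finset.mem_range.1 hk)
    set t : ℝ := (k : ℝ) / (2 * N) with ht
    have ht0 : 0 ≤ t := by positivity
    have ht1 : t ≤ 1 / 2 := by rw [ht, div_le_iff₀ (by positivity)]; linarith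
    have h1t : (1 - t) ≠ 0 := by linarith
    have hy' : ‖y - (x₀ + t • (x - x₀))‖ < ρ / 2 := mem_ball_iff_norm.1 hy
    have hz : x₀ + (1 - t)⁻¹ • (y - (x₀ + t • (x - x₀))) ∈ S := by
      apply hball
      rw [mem_ball_iff_norm, add_sub_cancel_left, norm_smul, Real.norm_of_nonneg
        (inv_nonneg.2 (by linarith)), inv_mul_lt_iff₀ (by linarith)]
      nlinarith
    have := hS hz hx (a := 1 - t) (b := t) (by linarith) ht0 (by ring)
    convert this using 1
    rw [smul_add, smul_smul, mul_inv_cancel₀ h1t]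
    module
  have hdisj : Set.PairwiseDisjoint (↑(Finset.range N)) B := by
    intro i _ j _ hij
    apply Metric.ball_disjoint_ball
    rw [dist_add_left, dist_eq_norm, ← sub_smul, norm_smul, ← sub_div, norm_div,
      Real.norm_of_nonneg (by positivity : (0 : ℝ) ≤ 2 * N)]
    have h1 : 1 ≤ ‖(i : ℝ) - j‖ := by
      have h2 : (1 : ℤ) ≤ |(i : ℤ) - j| := Int.one_le_abs (by omega)
      rw [Real.norm_eq_abs]
      exact_mod_cast h2
    rw [div_mul_eq_mul_div, le_div_iff₀ (by positivity)]
    nlinarith [norm_nonneg (x - x₀)]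
  have hm := measure_biUnion_finset (μ := volume) hdisj fun _ _ => Metric.isOpen_ball.measurableSet
  simp only [B, Measure.addHaar_ball_center, Finset.sum_const, Finset.card_range,
    nsmul_eq_mul] at hm
  have := measure_mono (μ := volume) hsub
  simp only [B] at this
  rw [hm] at this
  exact absurd this (not_le.2 hN)

/-- A proper log-concave function decays exponentially. -/
theorem IsProperLogConcave.exists_exp_bound (hf : IsProperLogConcave f) :
    ∃ (x₀ : Euc d) (C c : ℝ), 0 < C ∧ 0 < c ∧ ∀ x, f x ≤ C * Real.exp (-(c * ‖x - x₀‖)) := by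
  obtain ⟨x₀, ρ, m, hρ, hm, hball⟩ := hf.exists_ball
  set m' := m * Real.exp (-1) with hm'
  have hm'0 : 0 < m' := by positivity
  have hm'm : m' ≤ m := by
    have : Real.exp (-1) ≤ 1 := Real.exp_le_one_iff.2 (by norm_num)
    nlinarith
  have hvol : volume {x | m' ≤ f x} ≠ ⊤ := by
    have := hf.integrable.measure_norm_ge_lt_top hm'0
    refine (lt_of_le_of_lt (measure_mono fun x hx => ?_) this).ne
    exact le_trans hx (Real.le_norm_self _)
  obtain ⟨R, hR, hbd⟩ := exists_bound_of_convex_of_measure_ne_top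
    (hf.logConcave.convex_superlevel hm'0) hρ (fun x hx => hm'm.trans (hball x hx)) hvol
  obtain ⟨M, hM⟩ := (hf.upperSemicontinuous.upperSemicontinuousOn _).bddAbove_of_isCompact
    (isCompact_closedBall x₀ R)
  have hx₀ : m ≤ f x₀ := hball x₀ (Metric.mem_ball_self hρ)
  refine ⟨x₀, max m (M * Real.exp 1), R⁻¹, lt_max_of_lt_left hm, inv_pos.2 hR, fun x => ?_⟩
  rcases le_or_gt ‖x - x₀‖ R with h | h
  · have h1 : f x ≤ M := hM ⟨x, by rwa [mem_closedBall_iff_norm], rfl⟩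
    have h0 : 0 ≤ M := (hf.logConcave.1 x).trans h1
    calc f x ≤ M * Real.exp 1 * Real.exp (-1) := by
          rw [mul_assoc, ← Real.exp_add]; simpa using h1
      _ ≤ _ := by
          gcongr
          · exact le_max_right _ _
          · rw [inv_mul_le_iff₀ hR]; linarith
  · have hn : 0 < ‖x - x₀‖ := hR.trans h
    -- The point `z` of the segment at distance `R` from `x₀` has `f z < m / e`; log-concavity
    -- extrapolates this drop to `f x < m * exp (-1 / t)`.
    set t := R / ‖x - x₀‖ with ht
    have ht0 : 0 < t := by positivity
    have ht1 : t < 1 := (div_lt_one hn).2 h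
    set z := (1 - t) • x₀ + t • x with hz
    have hzx : ‖z - x₀‖ = R := by
      rw [show z - x₀ = t • (x - x₀) by rw [hz]; module, norm_smul, Real.norm_of_nonneg ht0.le, ht]
      field_simp
    have h1 : f z < m' := by
      by_contra! hh
      exact absurd (hbd z hh) (by rw [hzx]; exact lt_irrefl R)
    have h2 := hf.logConcave.2 x₀ x (1 - t) t (by linarith) ht0 (by ring)
    have h3 : f x < m * Real.exp (-(1 / t)) := by
      by_contra! hh
      have : m' ≤ f z := by
        calc m' = m ^ (1 - t) * (m * Real.exp (-(1 / t))) ^ t := by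
              rw [Real.mul_rpow hm.le (Real.exp_nonneg _), ← mul_assoc, ← Real.rpow_add hm,
                ← Real.exp_mul, hm']
              simp [ht0.ne']
          _ ≤ f x₀ ^ (1 - t) * f x ^ t := by
              have := hf.logConcave.1 x₀
              gcongr
          _ ≤ _ := h2
      linarith
    have h4 : 1 / t = R⁻¹ * ‖x - x₀‖ := by rw [ht]; field_simp
    rw [h4] at h3
    refine h3.le.trans ?_
    gcongr
    exact le_max_left _ _

/-! ### Parameters and integrals of majorants -/

theorem integrable_exp_neg_profile {ψ : ℝ → ℝ} (hψ : IsProfile ψ) :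
    Integrable fun x : Euc d => Real.exp (-ψ ‖x‖) := by
  have hc := hψ.pos 1 one_pos
  set c := ψ 1 with hcdef
  have hK : ∀ t : ℝ, 0 ≤ t → Real.exp (-ψ t) ≤
      (d + 1).factorial / c ^ (d + 1) * Real.exp (2 * c) * (1 + t) ^ (-((d : ℝ) + 1)) := by
    intro t ht
    have h1 := Real.pow_div_factorial_le_exp (c * (1 + t)) (by positivity) (d + 1)
    rw [div_le_iff₀ (by positivity), mul_pow] at h1
    have h2 := hψ.linear_lower_bound ht
    have h3 : (1 + t) ^ (-((d : ℝ) + 1)) = ((1 + t) ^ (d + 1))⁻¹ := by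
      rw [Real.rpow_neg (by positivity), ← Real.rpow_natCast]
      norm_num
    rw [h3, ← div_eq_mul_inv, le_div_iff₀ (by positivity)]
    calc Real.exp (-ψ t) * (1 + t) ^ (d + 1)
        ≤ Real.exp (c - c * t) * (1 + t) ^ (d + 1) := by gcongr; linarith
      _ ≤ Real.exp (c - c * t) * (Real.exp (c * (1 + t)) * (d + 1).factorial / c ^ (d + 1)) := by
        gcongr
        rw [le_div_iff₀ (by positivity)]
        linarith
      _ = _ := by
        rw [show 2 * c = (c - c * t) + c * (1 + t) by ring, Real.exp_add]
        ring
  have hint := (integrable_one_add_norm (E := Euc d) (μ := volume) (r := (d : ℝ) + 1)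
    (by simp)).const_mul ((d + 1).factorial / c ^ (d + 1) * Real.exp (2 * c))
  refine hint.mono' ?_ (ae_of_all _ fun x => ?_)
  · exact (Real.continuous_exp.comp (hψ.continuous.comp continuous_norm).neg).aestronglyMeasurable
  · rw [Real.norm_of_nonneg (Real.exp_nonneg _)]
    exact hK _ (norm_nonneg x)

theorem integral_exp_neg_profile_pos (d : ℕ) {ψ : ℝ → ℝ} (hψ : IsProfile ψ) :
    0 < ∫ x : Euc d, Real.exp (-ψ ‖x‖) :=
  integral_exp_pos (integrable_exp_neg_profile hψ)

/-- The function `x ↦ α exp (-ψ(|A x - b|))` with parameters `θ = (A, b, α)`. -/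
noncomputable def majorant (ψ : ℝ → ℝ) (θ : (Euc d →L[ℝ] Euc d) × Euc d × ℝ) (x : Euc d) : ℝ :=
  θ.2.2 * Real.exp (-ψ ‖θ.1 x - θ.2.1‖)

theorem exists_apply_eq {A : Euc d →L[ℝ] Euc d} (hA : A.det ≠ 0) (b : Euc d) : ∃ a, A a = b :=
  ⟨(A.toContinuousLinearEquivOfDetNeZero hA).symm b,
    (A.toContinuousLinearEquivOfDetNeZero hA).apply_symm_apply b⟩

theorem integral_majorant {ψ : ℝ → ℝ} {A : Euc d →L[ℝ] Euc d} (hA : A.det ≠ 0) (b : Euc d)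
    (α : ℝ) :
    ∫ x, majorant ψ (A, b, α) x = α / |A.det| * ∫ x : Euc d, Real.exp (-ψ ‖x‖) := by
  have h1 : ∫ x, Real.exp (-ψ ‖A x‖) = |A.det|⁻¹ * ∫ x : Euc d, Real.exp (-ψ ‖x‖) := by
    have hmap := Measure.map_linearMap_addHaar_eq_smul_addHaar (volume : Measure (Euc d))
      (f := (A : Euc d →ₗ[ℝ] Euc d)) hA
    have hemb : MeasurableEmbedding A :=
      (A.toContinuousLinearEquivOfDetNeZero hA).toHomeomorph.measurableEmbedding
    have := hemb.integral_map (μ := volume) fun x : Euc d => Real.exp (-ψ ‖x‖)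
    rw [← this]
    change ∫ y, _ ∂(Measure.map (A : Euc d →ₗ[ℝ] Euc d) volume) = _
    rw [hmap, integral_smul_measure, ENNReal.toReal_ofReal (abs_nonneg _), abs_inv]
    rfl
  obtain ⟨a, rfl⟩ := exists_apply_eq hA b
  simp only [majorant, ← map_sub]
  rw [integral_const_mul, integral_sub_right_eq_self (fun x => Real.exp (-ψ ‖A x‖)) a, h1]
  ring

theorem mem_ellipsoidalClass_iff {ψ : ℝ → ℝ} {L : Euc d → ℝ} :
    L ∈ ellipsoidalClass d ψ ↔ ∃ θ : (Euc d →L[ℝ] Euc d) × Euc d × ℝ,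
      θ.1.det ≠ 0 ∧ 0 < θ.2.2 ∧ L = majorant ψ θ := by
  constructor
  · rintro ⟨A, α, a, hα, h⟩
    refine ⟨((A : Euc d →L[ℝ] Euc d), A a, α), ?_, hα, funext fun x => ?_⟩
    · exact A.toLinearEquiv.isUnit_det'.ne_zero
    · simp [h x, majorant]
  · rintro ⟨⟨A, b, α⟩, hA, hα, rfl⟩
    obtain ⟨a, rfl⟩ : ∃ a, A a = b := exists_apply_eq hA b
    exact ⟨A.toContinuousLinearEquivOfDetNeZero hA, α, a, hα, fun x => by
      simp [majorant]⟩

/-- `θ` minimizes `α / |det A|` among the parameters of the majorants of `f`. -/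
structure IsMinimalParam (ψ : ℝ → ℝ) (f : Euc d → ℝ) (θ : (Euc d →L[ℝ] Euc d) × Euc d × ℝ) :
    Prop where
  det_ne_zero : θ.1.det ≠ 0
  pos : 0 < θ.2.2
  le_majorant : ∀ x, f x ≤ majorant ψ θ x
  minimal : ∀ θ' : (Euc d →L[ℝ] Euc d) × Euc d × ℝ, θ'.1.det ≠ 0 → 0 < θ'.2.2 →
    (∀ x, f x ≤ majorant ψ θ' x) → θ.2.2 / |θ.1.det| ≤ θ'.2.2 / |θ'.1.det|

theorem isMinimalMajorant_iff {ψ : ℝ → ℝ} (hψ : IsProfile ψ) {L : Euc d → ℝ} :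
    IsMinimalMajorant (ellipsoidalClass d ψ) f L ↔
      ∃ θ, IsMinimalParam ψ f θ ∧ L = majorant ψ θ := by
  have hpos := integral_exp_neg_profile_pos d hψ
  constructor
  · rintro ⟨hL, hle, hmin⟩
    obtain ⟨θ, hA, hα, rfl⟩ := mem_ellipsoidalClass_iff.1 hL
    refine ⟨θ, ⟨hA, hα, hle, fun θ' hA' hα' hle' => ?_⟩, rfl⟩
    have := hmin _ (mem_ellipsoidalClass_iff.2 ⟨θ', hA', hα', rfl⟩) hle'
    rw [integral_majorant hA, integral_majorant hA'] at this
    exact le_of_mul_le_mul_right this hpos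
  · rintro ⟨θ, hθ, rfl⟩
    refine ⟨mem_ellipsoidalClass_iff.2 ⟨θ, hθ.1, hθ.2, rfl⟩, hθ.3, fun ℓ hℓ hle => ?_⟩
    obtain ⟨θ', hA', hα', rfl⟩ := mem_ellipsoidalClass_iff.1 hℓ
    rw [integral_majorant hθ.1, integral_majorant hA']
    exact mul_le_mul_of_nonneg_right (hθ.4 θ' hA' hα' hle) hpos.le

theorem affineExpClass_eq (d : ℕ) : affineExpClass d = ellipsoidalClass d (psi 0) := by
  ext ℓ
  constructor
  · rintro ⟨T, α, hα, h⟩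
    refine ⟨T.linear.toContinuousLinearEquiv, α, T.symm 0, hα, fun x => ?_⟩
    have : T.linear (x - T.symm 0) = T x := by
      have := T.toAffineMap.linearMap_vsub x (T.symm 0)
      simpa using this
    simp [h x, psi_zero_left, this]
  · rintro ⟨A, α, a, hα, h⟩
    refine ⟨(AffineEquiv.constVAdd ℝ (Euc d) (-a)).trans A.toLinearEquiv.toAffineEquiv, α, hα,
      fun x => ?_⟩
    simp [h x, psi_zero_left, sub_eq_neg_add]

/-! ### Compactness and existence -/

/-- Parameters of the exponential majorants `α exp (C - c |A x - b|)` of `f` with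
`α / |det A|` at most `J`. -/
def relaxedParams (f : Euc d → ℝ) (C c J : ℝ) : Set ((Euc d →L[ℝ] Euc d) × Euc d × ℝ) :=
  {θ | 0 ≤ θ.2.2 ∧ (∀ x, f x ≤ θ.2.2 * Real.exp (C - c * ‖θ.1 x - θ.2.1‖)) ∧
    θ.2.2 ≤ J * |θ.1.det|}

theorem exists_bound_of_le_log_pow (K : ℝ) (d : ℕ) :
    ∃ U : ℝ, ∀ u, 0 < u → u ≤ K * Real.log u ^ d → u ≤ U := by
  have h := (Real.isLittleO_pow_log_id_atTop (n := d)).bound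
    (show 0 < 1 / (|K| + 1) by positivity)
  obtain ⟨U, hU⟩ := eventually_atTop.1 h
  refine ⟨U, fun u hu huK => ?_⟩
  by_contra! hlt
  have h1 := hU u hlt.le
  rw [id, Real.norm_of_nonneg hu.le] at h1
  have h2 : u ≤ |K| * (1 / (|K| + 1) * u) := by
    calc u ≤ K * Real.log u ^ d := huK
      _ ≤ |K * Real.log u ^ d| := le_abs_self _
      _ = |K| * ‖Real.log u ^ d‖ := by rw [abs_mul, Real.norm_eq_abs]
      _ ≤ _ := by gcongr
  have h3 : |K| * (1 / (|K| + 1) * u) < u := by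
    rw [← mul_assoc, mul_one_div, div_mul_eq_mul_div, div_lt_iff₀ (by positivity)]
    linarith
  linarith

/-- The image of the ball lies in a ball of radius `R`; compare volumes. -/
theorem abs_det_mul_pow_le {A : Euc d →L[ℝ] Euc d} {x₀ b : Euc d} {ρ R : ℝ} (hρ : 0 < ρ)
    (hR : 0 ≤ R) (h : ∀ x ∈ Metric.ball x₀ ρ, ‖A x - b‖ ≤ R) : |A.det| * ρ ^ d ≤ R ^ d := by
  have hsub : A '' Metric.ball x₀ ρ ⊆ Metric.closedBall b R := by
    rintro _ ⟨x, hx, rfl⟩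
    exact mem_closedBall_iff_norm.2 (h x hx)
  have hm := measure_mono (μ := volume) hsub
  rw [Measure.addHaar_image_continuousLinearMap, Measure.addHaar_ball_of_pos _ _ hρ,
    Measure.addHaar_closedBall _ _ hR, ← mul_assoc, ← ENNReal.ofReal_mul (abs_nonneg _),
    finrank_euclideanSpace, Fintype.card_fin] at hm
  have hv0 : volume (Metric.ball (0 : Euc d) 1) ≠ 0 :=
    (Metric.measure_ball_pos volume _ one_pos).ne'
  have hv1 : volume (Metric.ball (0 : Euc d) 1) ≠ ⊤ := measure_ball_lt_top.ne
  rwa [ENNReal.mul_le_mul_iff_left hv0 hv1, ENNReal.ofReal_le_ofReal_iff (by positivity)] at hm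

theorem IsProperLogConcave.exists_pos (hf : IsProperLogConcave f) : ∃ x, 0 < f x := by
  obtain ⟨x₀, ρ, m, hρ, hm, hball⟩ := hf.exists_ball
  exact ⟨x₀, hm.trans_le (hball x₀ (Metric.mem_ball_self hρ))⟩

/-- Since `f` is positive somewhere, `α > 0`, and then `α ≤ J |det A|` excludes `det A = 0`.
Nondegeneracy is thus automatic, and `relaxedParams` can be defined by closed conditions alone. -/
theorem IsProperLogConcave.pos_of_mem_relaxedParams (hf : IsProperLogConcave f) {C c J : ℝ}
    {θ : (Euc d →L[ℝ] Euc d) × Euc d × ℝ} (h : θ ∈ relaxedParams f C c J) :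
    0 < θ.2.2 ∧ θ.1.det ≠ 0 := by
  obtain ⟨x, hx⟩ := hf.exists_pos
  have hα : 0 < θ.2.2 := pos_of_mul_pos_left (hx.trans_le (h.2.1 x)) (Real.exp_nonneg _)
  refine ⟨hα, fun h0 => ?_⟩
  have := h.2.2
  rw [h0, abs_zero, mul_zero] at this
  linarith

theorem isClosed_relaxedParams (f : Euc d → ℝ) (C c J : ℝ) :
    IsClosed (relaxedParams f C c J) := by
  have hdet : Continuous fun θ : (Euc d →L[ℝ] Euc d) × Euc d × ℝ => θ.1.det :=
    ContinuousLinearMap.continuous_det.comp continuous_fst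
  refine (isClosed_le continuous_const (continuous_snd.comp continuous_snd)).inter (IsClosed.inter ?_ ?_)
  · change IsClosed {θ : (Euc d →L[ℝ] Euc d) × Euc d × ℝ | ∀ x, _}
    rw [Set.ofPred_forall]
    exact isClosed_iInter fun x => isClosed_le continuous_const (by fun_prop)
  · exact isClosed_le (by fun_prop) (continuous_const.mul hdet.abs)

theorem IsProperLogConcave.isCompact_relaxedParams (hf : IsProperLogConcave f) (C : ℝ) {c : ℝ}
    (hc : 0 < c) (J : ℝ) : IsCompact (relaxedParams f C c J) := by
  obtain ⟨x₀, ρ, m, hρ, hm, hball⟩ := hf.exists_ball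
  obtain ⟨U, hU⟩ := exists_bound_of_le_log_pow
    (J * (1 / (c * ρ)) ^ d / (m * Real.exp (-C))) d
  set q := m * Real.exp (-C) with hq
  have hq0 : 0 < q := by positivity
  have key : ∀ θ ∈ relaxedParams f C c J, ∀ x ∈ Metric.ball x₀ ρ,
      ‖θ.1 x - θ.2.1‖ ≤ Real.log (θ.2.2 / q) / c := by
    intro θ hθ x hx
    have hα := (hf.pos_of_mem_relaxedParams hθ).1
    have h1 : m ≤ θ.2.2 * Real.exp (C - c * ‖θ.1 x - θ.2.1‖) := (hball x hx).trans (hθ.2.1 x)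
    rw [le_div_iff₀ hc, Real.le_log_iff_exp_le (by positivity), le_div_iff₀ hq0]
    calc _ = m * (Real.exp (c * ‖θ.1 x - θ.2.1‖) * Real.exp (-C)) := by rw [hq, mul_comm c]; ring
      _ ≤ θ.2.2 * Real.exp (C - c * ‖θ.1 x - θ.2.1‖) *
          (Real.exp (c * ‖θ.1 x - θ.2.1‖) * Real.exp (-C)) := by gcongr
      _ = θ.2.2 * Real.exp ((C - c * ‖θ.1 x - θ.2.1‖) + (c * ‖θ.1 x - θ.2.1‖ + -C)) := by
          rw [Real.exp_add, Real.exp_add]; ring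
      _ = θ.2.2 := by
          rw [show (C - c * ‖θ.1 x - θ.2.1‖) + (c * ‖θ.1 x - θ.2.1‖ + -C) = 0 by ring]; simp
  have hα : ∀ θ ∈ relaxedParams f C c J, θ.2.2 / q ≤ U := by
    intro θ hθ
    obtain ⟨hα, hA⟩ := hf.pos_of_mem_relaxedParams hθ
    apply hU _ (by positivity)
    have hR : 0 ≤ Real.log (θ.2.2 / q) / c :=
      (norm_nonneg _).trans (key θ hθ x₀ (Metric.mem_ball_self hρ))
    have h1 := abs_det_mul_pow_le hρ hR (key θ hθ)
    have h2 : 0 ≤ J := by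
      by_contra! h
      nlinarith [hθ.2.2, abs_nonneg θ.1.det]
    have h3 : |θ.1.det| ≤ (Real.log (θ.2.2 / q) / c) ^ d / ρ ^ d := by
      rwa [le_div_iff₀ (by positivity)]
    calc θ.2.2 / q ≤ J * ((Real.log (θ.2.2 / q) / c) ^ d / ρ ^ d) / q := by
          gcongr
          exact hθ.2.2.trans (by gcongr)
      _ = _ := by rw [div_pow, one_div, inv_pow, mul_pow]; field_simp
  set R := Real.log U / c with hR
  have key2 : ∀ θ ∈ relaxedParams f C c J, ∀ x ∈ Metric.ball x₀ ρ, ‖θ.1 x - θ.2.1‖ ≤ R := by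
    intro θ hθ x hx
    refine (key θ hθ x hx).trans ?_
    have := (hf.pos_of_mem_relaxedParams hθ).1
    rw [hR]
    gcongr
    exact hα θ hθ
  have hA : ∀ θ ∈ relaxedParams f C c J, ‖θ.1‖ ≤ 2 * R / (ρ / 2) := by
    intro θ hθ
    have hx₀ := key2 θ hθ x₀ (Metric.mem_ball_self hρ)
    have hR0 : 0 ≤ R := (norm_nonneg _).trans hx₀
    refine ContinuousLinearMap.opNorm_le_bound _ (by positivity) fun z => ?_
    -- Subtracting the bounds at `x₀ + w` and `x₀` eliminates the unknown `b`.
    have hball : ∀ w : Euc d, ‖w‖ ≤ ρ / 2 → ‖θ.1 w‖ ≤ 2 * R := by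
      intro w hw
      have hw' : x₀ + w ∈ Metric.ball x₀ ρ := by
        rw [mem_ball_iff_norm, add_sub_cancel_left]
        linarith
      have h1 := key2 θ hθ _ hw'
      have h2 : θ.1 w = (θ.1 (x₀ + w) - θ.2.1) - (θ.1 x₀ - θ.2.1) := by rw [map_add]; abel
      rw [h2]
      exact (norm_sub_le _ _).trans (by linarith)
    rcases eq_or_ne z 0 with rfl | hz
    · simp
    have hz : 0 < ‖z‖ := norm_pos_iff.2 hz
    have h := hball ((ρ / 2 / ‖z‖) • z) (by
      rw [norm_smul, Real.norm_of_nonneg (by positivity), div_mul_cancel₀ _ hz.ne'])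
    rw [map_smul, norm_smul, Real.norm_of_nonneg (by positivity), div_mul_eq_mul_div,
      div_le_iff₀ hz] at h
    rw [div_mul_eq_mul_div, le_div_iff₀ (by positivity)]
    linarith
  refine IsCompact.of_isClosed_subset
    ((isCompact_closedBall (0 : Euc d →L[ℝ] Euc d) (2 * R / (ρ / 2))).prod
      ((isCompact_closedBall (0 : Euc d) (R + 2 * R / (ρ / 2) * ‖x₀‖)).prod
        (isCompact_closedBall (0 : ℝ) (U * q))))
    (isClosed_relaxedParams f C c J) fun θ hθ => ⟨?_, ?_, ?_⟩
  · exact mem_closedBall_zero_iff.2 (hA θ hθ)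
  · apply mem_closedBall_zero_iff.2
    have h1 := key2 θ hθ x₀ (Metric.mem_ball_self hρ)
    have h2 : ‖θ.1 x₀‖ ≤ 2 * R / (ρ / 2) * ‖x₀‖ :=
      (θ.1.le_opNorm x₀).trans (by gcongr; exact hA θ hθ)
    have h3 : θ.2.1 = θ.1 x₀ - (θ.1 x₀ - θ.2.1) := by abel
    rw [h3]
    exact (norm_sub_le _ _).trans (by linarith)
  · apply mem_closedBall_zero_iff.2
    rw [Real.norm_of_nonneg (hf.pos_of_mem_relaxedParams hθ).1.le, ← div_le_iff₀ hq0]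
    exact hα θ hθ

theorem continuous_majorant {ψ : ℝ → ℝ} (hψ : IsProfile ψ) :
    Continuous fun p : ((Euc d →L[ℝ] Euc d) × Euc d × ℝ) × Euc d => majorant ψ p.1 p.2 := by
  have := hψ.continuous
  unfold majorant
  fun_prop

theorem majorant_le_of_linear_le {ψ : ℝ → ℝ} {C c : ℝ} (h : ∀ t, 0 ≤ t → c * t - C ≤ ψ t)
    {θ : (Euc d →L[ℝ] Euc d) × Euc d × ℝ} (hα : 0 ≤ θ.2.2) (x : Euc d) :
    majorant ψ θ x ≤ θ.2.2 * Real.exp (C - c * ‖θ.1 x - θ.2.1‖) := by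
  unfold majorant
  gcongr
  linarith [h _ (norm_nonneg (θ.1 x - θ.2.1))]

theorem IsProperLogConcave.exists_isMinimalParam (hf : IsProperLogConcave f) {ψ : ℝ → ℝ}
    (hψ : IsProfile ψ) : ∃ θ, IsMinimalParam ψ f θ := by
  obtain ⟨x₀, C, c, hC, hc, hbd⟩ := hf.exists_exp_bound
  -- The decay bound itself is a majorant, because `ψ t ≤ t`.
  let θ₁ : (Euc d →L[ℝ] Euc d) × Euc d × ℝ := (c • ContinuousLinearMap.id ℝ _, c • x₀, C)
  have hdet₁ : θ₁.1.det ≠ 0 := by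
    simp [θ₁, ContinuousLinearMap.det, hc.ne']
  have hle₁ : ∀ x, f x ≤ majorant ψ θ₁ x := by
    intro x
    refine (hbd x).trans ?_
    have h1 : ‖θ₁.1 x - θ₁.2.1‖ = c * ‖x - x₀‖ := by
      simp [θ₁, ← smul_sub, norm_smul, abs_of_pos hc]
    unfold majorant
    rw [h1]
    change _ ≤ C * _
    gcongr
    exact hψ.le_self _ (by positivity)
  set J := C / |θ₁.1.det| with hJ
  set K : Set ((Euc d →L[ℝ] Euc d) × Euc d × ℝ) :=
    relaxedParams f (ψ 1) (ψ 1) J ∩ {θ | ∀ x, f x ≤ majorant ψ θ x} with hK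
  have hmem : ∀ θ : (Euc d →L[ℝ] Euc d) × Euc d × ℝ, 0 < θ.2.2 → θ.2.2 ≤ J * |θ.1.det| →
      (∀ x, f x ≤ majorant ψ θ x) → θ ∈ K := fun θ hα hJθ hle =>
    ⟨⟨hα.le, fun x => (hle x).trans (majorant_le_of_linear_le
      (fun t ht => hψ.linear_lower_bound ht) hα.le x), hJθ⟩, hle⟩
  have hKc : IsCompact K := by
    refine (hf.isCompact_relaxedParams _ (hψ.pos 1 one_pos) J).inter_right ?_
    rw [Set.ofPred_forall]
    exact isClosed_iInter fun x => isClosed_le continuous_const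
      ((continuous_majorant hψ).comp (by fun_prop : Continuous fun θ => (θ, x)))
  have hθ₁ : θ₁ ∈ K := by
    refine hmem θ₁ hC ?_ hle₁
    rw [hJ, div_mul_cancel₀ _ (abs_ne_zero.2 hdet₁)]
  have hcont : ContinuousOn (fun θ : (Euc d →L[ℝ] Euc d) × Euc d × ℝ => θ.2.2 / |θ.1.det|) K := by
    refine ContinuousOn.div (by fun_prop) ?_ fun θ hθ =>
      abs_ne_zero.2 (hf.pos_of_mem_relaxedParams hθ.1).2
    exact (ContinuousLinearMap.continuous_det.comp continuous_fst).abs.continuousOn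
  obtain ⟨θ, hθ, hmin⟩ := hKc.exists_isMinOn ⟨θ₁, hθ₁⟩ hcont
  obtain ⟨hα, hA⟩ := hf.pos_of_mem_relaxedParams hθ.1
  refine ⟨θ, hA, hα, hθ.2, fun θ' hA' hα' hle' => ?_⟩
  rcases le_total (θ'.2.2 / |θ'.1.det|) J with h | h
  · refine hmin (hmem θ' hα' ?_ hle')
    rwa [div_le_iff₀ (abs_pos.2 hA')] at h
  · exact (hmin hθ₁).trans h

/-! ### Uniqueness -/

/-- The diagonal operator with entries `l`. -/
noncomputable def diagonalMap (l : Fin d → ℝ) : Euc d →L[ℝ] Euc d :=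
  Matrix.toEuclideanCLM (𝕜 := ℝ) (Matrix.diagonal l)

theorem diagonalMap_apply (l : Fin d → ℝ) (x : Euc d) (i : Fin d) :
    diagonalMap l x i = l i * x i := by
  rw [diagonalMap, Matrix.ofLp_toEuclideanCLM, Matrix.mulVec_diagonal]

theorem det_diagonalMap (l : Fin d → ℝ) : (diagonalMap l).det = ∏ i, l i := by
  rw [ContinuousLinearMap.det, diagonalMap, Matrix.coe_toEuclideanCLM_eq_toEuclideanLin,
    Matrix.toEuclideanLin, Matrix.toLpLin_eq_toLin, LinearMap.det_toLin, Matrix.det_diagonal]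

theorem abs_det_eq_of_norm_eq {A B : Euc d →L[ℝ] Euc d} (hA : A.det ≠ 0) (hB : B.det ≠ 0)
    (h : ∀ x, ‖A x‖ = ‖B x‖) : |A.det| = |B.det| := by
  have hs : A ⁻¹' Metric.ball 0 1 = B ⁻¹' Metric.ball 0 1 := by
    ext x
    simp [h x]
  have hm := congrArg (volume : Measure (Euc d)) hs
  rw [Measure.addHaar_preimage_continuousLinearMap _ hA,
    Measure.addHaar_preimage_continuousLinearMap _ hB] at hm
  have hv0 : volume (Metric.ball (0 : Euc d) 1) ≠ 0 :=
    (Metric.measure_ball_pos volume _ one_pos).ne'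
  have hv1 : volume (Metric.ball (0 : Euc d) 1) ≠ ⊤ := measure_ball_lt_top.ne
  rw [ENNReal.mul_left_inj hv0 hv1, ENNReal.ofReal_eq_ofReal_iff (abs_nonneg _) (abs_nonneg _),
    abs_inv, abs_inv, inv_inj] at hm
  exact hm

/-- Simultaneous diagonalization of the quadratic forms `|A₁ x|²` and `|A₂ x|²`. -/
theorem exists_simultaneous_diagonalization {A₁ A₂ : Euc d →L[ℝ] Euc d} (h₁ : A₁.det ≠ 0)
    (h₂ : A₂.det ≠ 0) :
    ∃ (B : Euc d ≃L[ℝ] Euc d) (l : Fin d → ℝ), (∀ i, 0 < l i) ∧ (∀ x, ‖A₁ x‖ = ‖B x‖) ∧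
      ∀ x, ‖A₂ x‖ = ‖diagonalMap l (B x)‖ := by
  set e₁ := A₁.toContinuousLinearEquivOfDetNeZero h₁ with he₁
  set e₂ := A₂.toContinuousLinearEquivOfDetNeZero h₂ with he₂
  set M : Euc d →L[ℝ] Euc d := A₂ ∘L (e₁.symm : Euc d →L[ℝ] Euc d) with hM
  have hM0 : ∀ y, M y = 0 → y = 0 := fun y hy => by
    have : e₂ (e₁.symm y) = 0 := hy
    simpa using this
  -- With `M = A₂ A₁⁻¹`, `‖A₂ x‖ ^ 2` is the form of `S = M* M` at `A₁ x`. `B` is `A₁` followed by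
  -- coordinates in an eigenbasis of `S`.
  set S : Euc d →L[ℝ] Euc d := ContinuousLinearMap.adjoint M ∘L M with hS
  have hSinner : ∀ x y, inner ℝ (S x) y = inner ℝ (M x) (M y) := fun x y => by
    simp [hS, ContinuousLinearMap.adjoint_inner_left]
  have hsymm : (S : Euc d →ₗ[ℝ] Euc d).IsSymmetric := fun x y => by
    change inner ℝ (S x) y = inner ℝ x (S y)
    rw [hSinner, real_inner_comm, ← hSinner, real_inner_comm]
  have hn : Module.finrank ℝ (Euc d) = d := by simp
  set v := hsymm.eigenvectorBasis hn
  set μ := hsymm.eigenvalues hn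
  have hrepr : ∀ y i, v.repr (S y) i = μ i * v.repr y i := fun y i =>
    hsymm.eigenvectorBasis_apply_self_apply hn y i
  have hnorm : ∀ y, ‖M y‖ ^ 2 = ∑ i, μ i * v.repr y i ^ 2 := by
    intro y
    rw [← real_inner_self_eq_norm_sq, ← hSinner, ← v.repr.inner_map_map, PiLp.inner_apply]
    refine Finset.sum_congr rfl fun i _ => ?_
    rw [hrepr]
    simp
    ring
  have hμ : ∀ i, 0 < μ i := by
    intro i
    have h := hnorm (v i)
    have h2 : ∑ j, μ j * v.repr (v i) j ^ 2 = μ i := by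
      rw [v.repr_self, Finset.sum_eq_single i]
      · simp
      · intro j _ hj
        simp [hj]
      · simp
    rw [← h2, ← h]
    have : M (v i) ≠ 0 := fun h0 => by
      have := hM0 _ h0
      have h1 := v.orthonormal.1 i
      rw [this] at h1
      simp at h1
    positivity
  refine ⟨e₁.trans v.repr.toContinuousLinearEquiv, fun i => √(μ i),
    fun i => Real.sqrt_pos.2 (hμ i), fun x => ?_, fun x => ?_⟩
  · change ‖A₁ x‖ = ‖v.repr (A₁ x)‖
    rw [LinearIsometryEquiv.norm_map]
  · have h := hnorm (A₁ x)
    have hMA : M (A₁ x) = A₂ x := by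
      change A₂ (e₁.symm (e₁ x)) = A₂ x
      rw [e₁.symm_apply_apply]
    rw [hMA] at h
    refine (pow_left_inj₀ (norm_nonneg _) (norm_nonneg _) two_ne_zero).1 ?_
    rw [h, EuclideanSpace.norm_sq_eq]
    refine Finset.sum_congr rfl fun i _ => ?_
    rw [diagonalMap_apply, Real.norm_eq_abs, sq_abs, mul_pow, Real.sq_sqrt (hμ i).le]
    rfl

/-- Factorwise `((1 + l) / 2) ^ 2 ≥ l`, strictly unless `l = 1`; one strict factor makes the product
inequality strict. -/
theorem eq_one_of_prod_le {ι : Type*} [Fintype ι] {l : ι → ℝ} (hl : ∀ i, 0 < l i)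
    (h : (∏ i, (1 + l i) / 2) ^ 2 ≤ ∏ i, l i) (i : ι) : l i = 1 := by
  by_contra hi
  rw [← Finset.prod_pow] at h
  refine absurd h (not_le.2 (Finset.prod_lt_prod (fun j _ => hl j) (fun j _ => ?_)
    ⟨i, Finset.mem_univ i, ?_⟩))
  · nlinarith [sq_nonneg (l j - 1)]
  · have : l i - 1 ≠ 0 := sub_ne_zero.2 hi
    nlinarith [sq_pos_of_ne_zero this]

theorem IsMinimalParam.ratio_eq {ψ : ℝ → ℝ} {θ₁ θ₂ : (Euc d →L[ℝ] Euc d) × Euc d × ℝ}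
    (h₁ : IsMinimalParam ψ f θ₁) (h₂ : IsMinimalParam ψ f θ₂) :
    θ₁.2.2 / |θ₁.1.det| = θ₂.2.2 / |θ₂.1.det| :=
  le_antisymm (h₁.4 _ h₂.1 h₂.2 h₂.3) (h₂.4 _ h₁.1 h₁.2 h₁.3)

/-- Two minimal majorants have the same linear part, up to an isometry. -/
theorem IsMinimalParam.norm_apply_eq {ψ : ℝ → ℝ} (hψ : IsProfile ψ) (hf0 : ∀ x, 0 ≤ f x)
    {θ₁ θ₂ : (Euc d →L[ℝ] Euc d) × Euc d × ℝ}
    (h₁ : IsMinimalParam ψ f θ₁) (h₂ : IsMinimalParam ψ f θ₂) (x : Euc d) :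
    ‖θ₁.1 x‖ = ‖θ₂.1 x‖ := by
  obtain ⟨B, l, hl, hB₁, hB₂⟩ := exists_simultaneous_diagonalization h₁.1 h₂.1
  have hratio := h₁.ratio_eq h₂
  obtain ⟨A₁, b₁, α₁⟩ := θ₁
  obtain ⟨A₂, b₂, α₂⟩ := θ₂
  obtain ⟨hA₁, hα₁, hle₁, hmin⟩ := h₁
  obtain ⟨hA₂, hα₂, hle₂, -⟩ := h₂
  dsimp only at *
  obtain ⟨a₁, rfl⟩ := exists_apply_eq hA₁ b₁
  obtain ⟨a₂, rfl⟩ := exists_apply_eq hA₂ b₂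
  have hBdet : (B : Euc d →L[ℝ] Euc d).det ≠ 0 := B.toLinearEquiv.isUnit_det'.ne_zero
  have hcomp : ∀ k : Fin d → ℝ, (diagonalMap k ∘L (B : Euc d →L[ℝ] Euc d)).det =
      (∏ i, k i) * (B : Euc d →L[ℝ] Euc d).det := fun k => by
    rw [← det_diagonalMap]
    exact LinearMap.det_comp _ _
  have hlprod : 0 < ∏ i, l i := Finset.prod_pos fun i _ => hl i
  have hkprod : 0 < ∏ i, (1 + l i) / 2 := Finset.prod_pos fun i _ => by linarith [hl i]
  have hd₁ : |A₁.det| = |(B : Euc d →L[ℝ] Euc d).det| := abs_det_eq_of_norm_eq hA₁ hBdet hB₁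
  have hd₂ : |A₂.det| = (∏ i, l i) * |(B : Euc d →L[ℝ] Euc d).det| := by
    rw [abs_det_eq_of_norm_eq hA₂ (B := diagonalMap l ∘L (B : Euc d →L[ℝ] Euc d)) _ hB₂, hcomp,
      abs_mul, abs_of_pos hlprod]
    rw [hcomp]
    exact mul_ne_zero hlprod.ne' hBdet
  set A := diagonalMap (fun i => (1 + l i) / 2) ∘L (B : Euc d →L[ℝ] Euc d) with hA
  have hd : A.det = (∏ i, (1 + l i) / 2) * (B : Euc d →L[ℝ] Euc d).det := hcomp _
  have hbpos : 0 < |(B : Euc d →L[ℝ] Euc d).det| := abs_pos.2 hBdet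
  set β := |(B : Euc d →L[ℝ] Euc d).det|
  -- The averaged competitor dominates the geometric mean of the two majorants, by the triangle
  -- inequality and convexity of `ψ`.
  have hfeas : ∀ x, f x ≤ majorant ψ
      (A, (1 / 2 : ℝ) • (B a₁ + diagonalMap l (B a₂)), √(α₁ * α₂)) x := by
    intro x
    have e : A x - (1 / 2 : ℝ) • (B a₁ + diagonalMap l (B a₂)) =
        (1 / 2 : ℝ) • (B (x - a₁) + diagonalMap l (B (x - a₂))) := by
      ext i
      simp [hA, diagonalMap_apply]
      ring
    have hn : ‖A x - (1 / 2 : ℝ) • (B a₁ + diagonalMap l (B a₂))‖ ≤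
        (‖A₁ x - A₁ a₁‖ + ‖A₂ x - A₂ a₂‖) / 2 := by
      rw [e, norm_smul, ← map_sub, ← map_sub, hB₁, hB₂]
      have := norm_add_le (B (x - a₁)) (diagonalMap l (B (x - a₂)))
      rw [Real.norm_of_nonneg (by norm_num)]
      linarith
    have hψm := hψ.midpoint_le (norm_nonneg _) (norm_nonneg _) (norm_nonneg _) hn
    have h1 := hle₁ x
    have h2 := hle₂ x
    simp only [majorant] at h1 h2 ⊢
    refine (pow_le_pow_iff_left₀ (hf0 x) (by positivity) two_ne_zero).1 ?_
    calc f x ^ 2 = f x * f x := sq _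
      _ ≤ (α₁ * Real.exp (-ψ ‖A₁ x - A₁ a₁‖)) * (α₂ * Real.exp (-ψ ‖A₂ x - A₂ a₂‖)) := by
          have := hf0 x
          gcongr
      _ = α₁ * α₂ * Real.exp (-(ψ ‖A₁ x - A₁ a₁‖ + ψ ‖A₂ x - A₂ a₂‖)) := by
          rw [neg_add, Real.exp_add]; ring
      _ ≤ α₁ * α₂ * Real.exp (2 * -ψ ‖A x - (1 / 2 : ℝ) • (B a₁ + diagonalMap l (B a₂))‖) := by
          gcongr
          linarith
      _ = _ := by
          rw [mul_pow, Real.sq_sqrt (by positivity), ← Real.exp_nat_mul]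
          norm_num
  have hm := hmin _ (by rw [hd]; exact mul_ne_zero hkprod.ne' hBdet)
    (Real.sqrt_pos.2 (mul_pos hα₁ hα₂)) hfeas
  dsimp only at hm
  rw [hd, abs_mul, abs_of_pos hkprod, hd₁] at hm
  rw [hd₁, hd₂, div_eq_div_iff hbpos.ne' (by positivity)] at hratio
  have hα : α₂ = α₁ * ∏ i, l i := by
    have : α₂ * β = (α₁ * ∏ i, l i) * β := by linarith
    exact mul_right_cancel₀ hbpos.ne' this
  have hprod : (∏ i, (1 + l i) / 2) ^ 2 ≤ ∏ i, l i := by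
    rw [hα, show α₁ * (α₁ * ∏ i, l i) = α₁ ^ 2 * ∏ i, l i by ring, Real.sqrt_mul (by positivity),
      Real.sqrt_sq hα₁.le, div_le_div_iff₀ hbpos (by positivity)] at hm
    have hle : ∏ i, (1 + l i) / 2 ≤ √(∏ i, l i) := by
      have : (α₁ * β) * ∏ i, (1 + l i) / 2 ≤ (α₁ * β) * √(∏ i, l i) := by linarith
      exact le_of_mul_le_mul_left this (by positivity)
    exact (Real.le_sqrt hkprod.le hlprod.le).1 hle
  have hone := eq_one_of_prod_le hl hprod
  rw [hB₁, hB₂]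
  congr 1
  ext i
  simp [diagonalMap_apply, hone]

/-- By the parallelogram law the left side is the quadratic mean of the two norms. -/
theorem sqrt_norm_sq_add_le_max {E : Type*} [NormedAddCommGroup E] [InnerProductSpace ℝ E]
    (y v : E) : √(‖y‖ ^ 2 + ‖v‖ ^ 2) ≤ max ‖y - v‖ ‖y + v‖ := by
  refine Real.sqrt_le_iff.2 ⟨le_max_of_le_left (norm_nonneg _), ?_⟩
  have h1 := norm_sub_sq_real y v
  have h2 := norm_add_sq_real y v
  have h3 : ‖y - v‖ ^ 2 ≤ (max ‖y - v‖ ‖y + v‖) ^ 2 := by gcongr; exact le_max_left _ _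
  have h4 : ‖y + v‖ ^ 2 ≤ (max ‖y - v‖ ‖y + v‖) ^ 2 := by gcongr; exact le_max_right _ _
  linarith

/-- The centers of two minimal majorants with the same linear part and factor coincide. -/
theorem IsMinimalParam.center_eq {ψ : ℝ → ℝ} (hψ : IsProfile ψ) {A : Euc d →L[ℝ] Euc d}
    {a₁ a₂ : Euc d} {α : ℝ} (h₁ : IsMinimalParam ψ f (A, A a₁, α))
    (hle₂ : ∀ x, f x ≤ majorant ψ (A, A a₂, α) x) : A a₁ = A a₂ := by
  by_contra hne
  obtain ⟨hA, hα, hle₁, hmin⟩ := h₁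
  dsimp only at *
  set v : Euc d := (1 / 2 : ℝ) • (A a₁ - A a₂) with hv
  have hv0 : 0 < ‖v‖ := norm_pos_iff.2 (smul_ne_zero (by norm_num) (sub_ne_zero.2 hne))
  obtain ⟨ε, δ, hε0, hε1, hδ, hdil⟩ := hψ.exists_dilation hv0 d
  set c : Euc d := (1 / 2 : ℝ) • (A a₁ + A a₂) with hc
  have hdet : ((1 - ε) • A).det = (1 - ε) ^ d * A.det := by
    have := LinearMap.det_smul (1 - ε) (A : Euc d →ₗ[ℝ] Euc d)
    rw [finrank_euclideanSpace, Fintype.card_fin] at this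
    exact this
  have hpow : 0 < (1 - ε) ^ d := pow_pos (by linarith) d
  -- Competitor centered midway: dilating costs `(1 - ε) ^ d` in the determinant, but the factor
  -- drops by `exp (-δ)`, which is smaller.
  have hm := hmin ((1 - ε) • A, (1 - ε) • c, α * Real.exp (-δ))
    (by rw [hdet]; exact mul_ne_zero hpow.ne' hA) (by positivity) (fun x => by
      have h1 := hle₁ x
      have h2 := hle₂ x
      simp only [majorant] at h1 h2 ⊢
      have e1 : A x - A a₁ = (A x - c) - v := by rw [hv, hc]; module
      have e2 : A x - A a₂ = (A x - c) + v := by rw [hv, hc]; module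
      have e3 : ‖((1 - ε) • A) x - (1 - ε) • c‖ = (1 - ε) * ‖A x - c‖ := by
        rw [smul_apply, ← smul_sub, norm_smul,
          Real.norm_of_nonneg (by linarith)]
      rw [e1] at h1
      rw [e2] at h2
      rw [e3, mul_assoc, ← Real.exp_add]
      have h3 := hdil _ (norm_nonneg (A x - c))
      have h4 := hψ.mono (Real.sqrt_nonneg _) (sqrt_norm_sq_add_le_max (A x - c) v)
      rcases max_choice ‖A x - c - v‖ ‖A x - c + v‖ with h | h
      · rw [h] at h4
        refine h1.trans ?_
        gcongr
        linarith
      · rw [h] at h4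
        refine h2.trans ?_
        gcongr
        linarith)
  dsimp only at hm
  rw [hdet, abs_mul, abs_of_pos hpow] at hm
  have hA' := abs_pos.2 hA
  rw [div_le_div_iff₀ hA' (by positivity)] at hm
  have : (α * |A.det|) * (1 - ε) ^ d ≤ (α * |A.det|) * Real.exp (-δ) := by linarith
  have := le_of_mul_le_mul_left this (by positivity)
  linarith

theorem IsMinimalParam.majorant_eq {ψ : ℝ → ℝ} (hψ : IsProfile ψ) (hf0 : ∀ x, 0 ≤ f x)
    {θ₁ θ₂ : (Euc d →L[ℝ] Euc d) × Euc d × ℝ}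
    (h₁ : IsMinimalParam ψ f θ₁) (h₂ : IsMinimalParam ψ f θ₂) :
    majorant ψ θ₁ = majorant ψ θ₂ := by
  have hnorm := h₁.norm_apply_eq hψ hf0 h₂
  have hratio := h₁.ratio_eq h₂
  rw [abs_det_eq_of_norm_eq h₁.1 h₂.1 hnorm, div_left_inj' (abs_ne_zero.2 h₂.1)] at hratio
  obtain ⟨A₁, b₁, α₁⟩ := θ₁
  obtain ⟨A₂, b₂, α₂⟩ := θ₂
  dsimp only at hnorm hratio
  subst hratio
  obtain ⟨a₁, rfl⟩ : ∃ a, A₁ a = b₁ := exists_apply_eq h₁.1 b₁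
  obtain ⟨a₂, rfl⟩ : ∃ a, A₂ a = b₂ := exists_apply_eq h₂.1 b₂
  have e : majorant ψ (A₂, A₂ a₂, α₁) = majorant ψ (A₁, A₁ a₂, α₁) := by
    funext x
    simp only [majorant, ← map_sub, hnorm]
  have hle := h₂.3
  rw [e] at hle ⊢
  rw [h₁.center_eq hψ hle]

theorem existsUnique_isMinimalMajorant (hf : IsProperLogConcave f) {ψ : ℝ → ℝ}
    (hψ : IsProfile ψ) : ∃! L, IsMinimalMajorant (ellipsoidalClass d ψ) f L := by
  obtain ⟨θ, hθ⟩ := hf.exists_isMinimalParam hψ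
  refine ⟨_, (isMinimalMajorant_iff hψ).2 ⟨θ, hθ, rfl⟩, fun L hL => ?_⟩
  obtain ⟨θ', hθ', rfl⟩ := (isMinimalMajorant_iff hψ).1 hL
  exact hθ'.majorant_eq hψ hf.logConcave.1 hθ

/-! ### Convergence as `s → 0` -/

theorem tendsto_norm_apply_sub_atTop {ι : Type*} {l : Filter ι} {A : ι → Euc d →L[ℝ] Euc d}
    {b x : ι → Euc d} {A₀ : Euc d →L[ℝ] Euc d} {b₀ : Euc d} (hA₀ : A₀.det ≠ 0)
    (hA : Tendsto A l (𝓝 A₀)) (hb : Tendsto b l (𝓝 b₀))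
    (hx : Tendsto (fun i => ‖x i‖) l atTop) :
    Tendsto (fun i => ‖A i (x i) - b i‖) l atTop := by
  set e := A₀.toContinuousLinearEquivOfDetNeZero hA₀
  set k : ℝ := 1 / (‖(e.symm : Euc d →L[ℝ] Euc d)‖ + 1) with hk
  have hk0 : 0 < k := by positivity
  have hlow : ∀ y, k * ‖y‖ ≤ ‖A₀ y‖ := by
    intro y
    have h1 := (e.symm : Euc d →L[ℝ] Euc d).le_opNorm (A₀ y)
    have h2 : (e.symm : Euc d →L[ℝ] Euc d) (A₀ y) = y := e.symm_apply_apply y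
    rw [h2] at h1
    rw [hk, one_div, inv_mul_le_iff₀ (by positivity)]
    nlinarith [norm_nonneg (A₀ y)]
  have h1 : ∀ᶠ i in l, ‖A i - A₀‖ < k / 2 := by
    have := (tendsto_iff_norm_sub_tendsto_zero.1 hA).eventually (gt_mem_nhds (half_pos hk0))
    exact this
  have h2 : ∀ᶠ i in l, ‖b i‖ < ‖b₀‖ + 1 :=
    hb.norm.eventually (gt_mem_nhds (lt_add_one _))
  have h3 : Tendsto (fun i => k / 2 * ‖x i‖ - (‖b₀‖ + 1)) l atTop :=
    tendsto_atTop_add_const_right _ _ (hx.const_mul_atTop (half_pos hk0))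
  refine tendsto_atTop_mono' l ?_ h3
  filter_upwards [h1, h2] with i hi1 hi2
  have e1 : A₀ (x i) = (A i (x i) - b i) + b i - (A i - A₀) (x i) := by
    rw [sub_apply]; abel
  have e2 := hlow (x i)
  rw [e1] at e2
  have e3 := norm_sub_le ((A i (x i) - b i) + b i) ((A i - A₀) (x i))
  have e4 := norm_add_le (A i (x i) - b i) (b i)
  have e5 : ‖(A i - A₀) (x i)‖ ≤ k / 2 * ‖x i‖ :=
    ((A i - A₀).le_opNorm _).trans (by gcongr)
  linarith

theorem tendsto_majorant_psi {ι : Type*} {l : Filter ι} {s : ι → ℝ}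
    {θ : ι → (Euc d →L[ℝ] Euc d) × Euc d × ℝ} {θ₀ : (Euc d →L[ℝ] Euc d) × Euc d × ℝ}
    {x : ι → Euc d} {x₀ : Euc d} (hs : Tendsto s l (𝓝 0)) (hs0 : ∀ᶠ i in l, 0 ≤ s i)
    (hθ : Tendsto θ l (𝓝 θ₀)) (hx : Tendsto x l (𝓝 x₀)) :
    Tendsto (fun i => majorant (psi (s i)) (θ i) (x i)) l (𝓝 (majorant (psi 0) θ₀ x₀)) := by
  have hA : Tendsto (fun i => (θ i).1) l (𝓝 θ₀.1) := hθ.fst_nhds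
  have hα : Tendsto (fun i => (θ i).2.2) l (𝓝 θ₀.2.2) := hθ.snd_nhds.snd_nhds
  have hb : Tendsto (fun i => (θ i).2.1) l (𝓝 θ₀.2.1) := hθ.snd_nhds.fst_nhds
  have hAx : Tendsto (fun i => (θ i).1 (x i)) l (𝓝 (θ₀.1 x₀)) :=
    (isBoundedBilinearMap_apply.continuous.tendsto (θ₀.1, x₀)).comp (hA.prodMk_nhds hx)
  have ht : Tendsto (fun i => ‖(θ i).1 (x i) - (θ i).2.1‖) l (𝓝 ‖θ₀.1 x₀ - θ₀.2.1‖) :=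
    (hAx.sub hb).norm
  have := hα.mul ((tendsto_psi hs hs0 (fun i => norm_nonneg _) ht).neg.rexp)
  simpa only [majorant, psi_zero_left] using this

theorem tendsto_majorant_psi_zero {ι : Type*} {l : Filter ι} {s : ι → ℝ}
    {θ : ι → (Euc d →L[ℝ] Euc d) × Euc d × ℝ} {θ₀ : (Euc d →L[ℝ] Euc d) × Euc d × ℝ}
    {x : ι → Euc d} (hdet : θ₀.1.det ≠ 0) (hs0 : ∀ᶠ i in l, 0 ≤ s i) (hs1 : ∀ᶠ i in l, s i ≤ 1)
    (hα : ∀ᶠ i in l, 0 ≤ (θ i).2.2) (hθ : Tendsto θ l (𝓝 θ₀))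
    (hx : Tendsto (fun i => ‖x i‖) l atTop) :
    Tendsto (fun i => majorant (psi (s i)) (θ i) (x i)) l (𝓝 0) := by
  have ht := tendsto_norm_apply_sub_atTop hdet hθ.fst_nhds hθ.snd_nhds.fst_nhds hx
  have hexp : Tendsto (fun i => Real.exp (1 - 1 / 2 * ‖(θ i).1 (x i) - (θ i).2.1‖)) l (𝓝 0) := by
    refine Real.tendsto_exp_atBot.comp ?_
    have := tendsto_neg_atTop_atBot.comp (ht.const_mul_atTop (show (0 : ℝ) < 1 / 2 by norm_num))
    exact tendsto_atBot_add_const_left _ 1 this |>.congr fun i => by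
      simp [sub_eq_add_neg]
  have hlim := hθ.snd_nhds.snd_nhds.mul hexp
  rw [mul_zero] at hlim
  refine tendsto_of_tendsto_of_tendsto_of_le_of_le' tendsto_const_nhds hlim ?_ ?_
  · filter_upwards [hα] with i hi using mul_nonneg hi (Real.exp_nonneg _)
  · filter_upwards [hα, hs0, hs1] with i hi h0 h1 using
      majorant_le_of_linear_le (fun t ht => half_sub_one_le_psi h0 h1 ht) hi _

/-- As `ψ_s ≤ ψ_0`, the minimizer for `s = 0` is admissible for `s`, which bounds the ratio by a
constant free of `s`. -/
theorem IsMinimalParam.mem_relaxedParams {θ θ₀ : (Euc d →L[ℝ] Euc d) × Euc d × ℝ} {s : ℝ}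
    (hs0 : 0 ≤ s) (hs1 : s ≤ 1) (hθ : IsMinimalParam (psi s) f θ)
    (hθ₀ : IsMinimalParam (psi 0) f θ₀) :
    θ ∈ relaxedParams f 1 (1 / 2) (θ₀.2.2 / |θ₀.1.det|) := by
  refine ⟨hθ.pos.le, fun x => (hθ.le_majorant x).trans (majorant_le_of_linear_le
    (fun t ht => half_sub_one_le_psi hs0 hs1 ht) hθ.pos.le x), ?_⟩
  rw [← div_le_iff₀ (abs_pos.2 hθ.det_ne_zero)]
  refine hθ.minimal θ₀ hθ₀.det_ne_zero hθ₀.pos fun x => (hθ₀.le_majorant x).trans ?_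
  have := hθ₀.pos
  unfold majorant
  gcongr
  rw [psi_zero_left]
  exact psi_le_self hs0 (norm_nonneg _)

theorem tendstoUniformly_majorant (hf : IsProperLogConcave f)
    {θ : ℝ → (Euc d →L[ℝ] Euc d) × Euc d × ℝ} {θ₀ : (Euc d →L[ℝ] Euc d) × Euc d × ℝ}
    (hθ : ∀ s, 0 < s → IsMinimalParam (psi s) f (θ s)) (hθ₀ : IsMinimalParam (psi 0) f θ₀) :
    TendstoUniformly (fun s => majorant (psi s) (θ s)) (majorant (psi 0) θ₀) (𝓝[>] (0 : ℝ)) := by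
  rw [Metric.tendstoUniformly_iff]
  by_contra! h
  obtain ⟨ε, hε, h⟩ := h
  choose! X hX using fun s
    (hs : ∃ x, ε ≤ dist (majorant (psi 0) θ₀ x) (majorant (psi s) (θ s) x)) => hs
  have := frequently_iff_neBot.1 h
  -- Along an ultrafilter of bad `s`, parameters in a compact set converge without passing to
  -- subsequences.
  let U := Ultrafilter.of (𝓝[>] (0 : ℝ) ⊓ 𝓟 {s | ∃ x, ε ≤ dist (majorant (psi 0) θ₀ x)
    (majorant (psi s) (θ s) x)})
  have hUle := Ultrafilter.of_le (𝓝[>] (0 : ℝ) ⊓ 𝓟 {s | ∃ x, ε ≤ dist (majorant (psi 0) θ₀ x)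
    (majorant (psi s) (θ s) x)})
  have hU1 : (U : Filter ℝ) ≤ 𝓝[>] (0 : ℝ) := hUle.trans inf_le_left
  have hbad : ∀ᶠ s in (U : Filter ℝ),
      ε ≤ dist (majorant (psi 0) θ₀ (X s)) (majorant (psi s) (θ s) (X s)) :=
    (le_principal_iff.1 (hUle.trans inf_le_right) : _ ∈ (U : Filter ℝ)) |> fun h =>
      Filter.mem_of_superset h hX
  have hs : Tendsto (fun s : ℝ => s) U (𝓝 0) := hU1.trans nhdsWithin_le_nhds
  have hpos : ∀ᶠ s in (U : Filter ℝ), 0 < s := hU1 self_mem_nhdsWithin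
  have hs0 : ∀ᶠ s in (U : Filter ℝ), 0 ≤ s := hpos.mono fun s h => h.le
  have hs1 : ∀ᶠ s in (U : Filter ℝ), s ≤ 1 := hs.eventually (ge_mem_nhds one_pos)
  set J := θ₀.2.2 / |θ₀.1.det|
  have hK : ∀ᶠ s in (U : Filter ℝ), θ s ∈ relaxedParams f 1 (1 / 2) J := by
    filter_upwards [hpos, hs1] with s h0 h1 using (hθ s h0).mem_relaxedParams h0.le h1 hθ₀
  obtain ⟨θ', hθ'K, hlim⟩ := (hf.isCompact_relaxedParams 1 (by norm_num : (0 : ℝ) < 1 / 2)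
    J).ultrafilter_le_nhds (U.map θ) (le_principal_iff.2 hK)
  have hlim : Tendsto θ U (𝓝 θ') := hlim
  obtain ⟨hα', hA'⟩ := hf.pos_of_mem_relaxedParams hθ'K
  have hmin' : IsMinimalParam (psi 0) f θ' := by
    refine ⟨hA', hα', fun x => ?_, fun θ'' h1 h2 h3 => ?_⟩
    · refine ge_of_tendsto (tendsto_majorant_psi hs hs0 hlim (tendsto_const_nhds (x := x))) ?_
      filter_upwards [hpos] with s h0 using (hθ s h0).le_majorant x
    · refine le_trans ?_ (hθ₀.minimal θ'' h1 h2 h3)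
      rw [div_le_iff₀ (abs_pos.2 hA')]
      exact hθ'K.2.2
  -- The limit parameter `θ'` may differ from `θ₀` by an isometry, but the functions coincide.
  rw [hθ₀.majorant_eq isProfile_psi_zero hf.logConcave.1 hmin'] at hbad
  have hαs : ∀ᶠ s in (U : Filter ℝ), 0 ≤ (θ s).2.2 := hpos.mono fun s h => (hθ s h).pos.le
  have hdist : Tendsto (fun s => dist (majorant (psi 0) θ' (X s)) (majorant (psi s) (θ s) (X s)))
      U (𝓝 0) := by
    -- Along an ultrafilter the bad points are either eventually bounded, hence convergent, or their
    -- norms tend to infinity.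
    by_cases hbd : ∃ R : ℝ, ∀ᶠ s in (U : Filter ℝ), ‖X s‖ ≤ R
    · obtain ⟨R, hR⟩ := hbd
      obtain ⟨x₀, -, hx₀⟩ := (isCompact_closedBall (0 : Euc d) R).ultrafilter_le_nhds (U.map X)
        (le_principal_iff.2 (hR.mono fun s h => mem_closedBall_zero_iff.2 h))
      have hx₀ : Tendsto X U (𝓝 x₀) := hx₀
      have := (tendsto_majorant_psi (s := fun _ => 0) (θ := fun _ => θ') tendsto_const_nhds
        (Eventually.of_forall fun _ => le_rfl) tendsto_const_nhds hx₀).dist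
        (tendsto_majorant_psi hs hs0 hlim hx₀)
      rwa [dist_self] at this
    · push Not at hbd
      have hX : Tendsto (fun s => ‖X s‖) U atTop :=
        tendsto_atTop.2 fun R => (hbd R).mono fun s h => h.le
      have := (tendsto_majorant_psi_zero (s := fun _ => 0) (θ := fun _ => θ') hA'
        (Eventually.of_forall fun _ => le_rfl) (Eventually.of_forall fun _ => zero_le_one)
        (Eventually.of_forall fun _ => hα'.le) tendsto_const_nhds hX).dist
        (tendsto_majorant_psi_zero hA' hs0 hs1 hαs hlim hX)
      rwa [dist_self] at this
  have := ge_of_tendsto hdist hbad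
  linarith

end Lowner

theorem theorem1p3 (d : ℕ) (f : EuclideanSpace ℝ (Fin d) → ℝ)
    (hf : Lowner.IsProperLogConcave f) :
    (∀ s : ℝ, 0 ≤ s → ∃! L : EuclideanSpace ℝ (Fin d) → ℝ, Lowner.IsLownerFunction s f L) ∧
    (∃! L₀ : EuclideanSpace ℝ (Fin d) → ℝ, Lowner.IsLownerFunctionLSW f L₀) ∧
    (∀ L₀ : EuclideanSpace ℝ (Fin d) → ℝ,
      Lowner.IsLownerFunctionLSW f L₀ ↔ Lowner.IsLownerFunction 0 f L₀) ∧
    ∀ (L : ℝ → EuclideanSpace ℝ (Fin d) → ℝ) (L₀ : EuclideanSpace ℝ (Fin d) → ℝ),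
      (∀ s : ℝ, 0 < s → Lowner.IsLownerFunction s f (L s)) →
      Lowner.IsLownerFunctionLSW f L₀ →
      TendstoUniformly L L₀ (𝓝[>] (0 : ℝ)) := by
  have hiff : ∀ L₀, Lowner.IsLownerFunctionLSW f L₀ ↔ Lowner.IsLownerFunction 0 f L₀ := fun L₀ => by
    rw [Lowner.IsLownerFunctionLSW, Lowner.affineExpClass_eq, Lowner.IsLownerFunction]
  refine ⟨fun s hs => Lowner.existsUnique_isMinimalMajorant hf (Lowner.isProfile_psi hs), ?_, hiff,
    fun L L₀ hL hL₀ => ?_⟩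
  · simp only [hiff]
    exact Lowner.existsUnique_isMinimalMajorant hf Lowner.isProfile_psi_zero
  · obtain ⟨θ₀, hθ₀, rfl⟩ :=
      (Lowner.isMinimalMajorant_iff Lowner.isProfile_psi_zero).1 ((hiff L₀).1 hL₀)
    choose! θ hθ using fun s hs =>
      (Lowner.isMinimalMajorant_iff (Lowner.isProfile_psi (le_of_lt hs))).1 (hL s hs)
    intro u hu
    filter_upwards [Lowner.tendstoUniformly_majorant hf (fun s hs => (hθ s hs).1) hθ₀ u hu,
      self_mem_nhdsWithin] with s h hs x
    rw [(hθ s hs).2]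
    exact h x
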